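/- Let $\gamma\ge 1$, $\mu>0$, $k>0$, and let the end states $(P^\pm,J^\pm)\in\mathbb R^2$ and the speed $s\in\mathbb R$ satisfy the Rankine--Hugoniot conditions $$J^+-J^-=s(P^+-P^-),\qquad \Big(\frac{(J^+)^2}{P^+}+(P^+)^\gamma\Big)-\Big(\frac{(J^-)^2}{P^-}+(P^-)^\gamma\Big)=s(J^+-J^-).$$ Put $A=sP^\pm-J^\pm$ and $B=-sJ^\pm+\frac{(J^\pm)^2}{P^\pm}+(P^\pm)^\gamma$ (by these conditions, both choices of sign give the same values), and $f(P)=P^\gamma-(As+B)+\frac{A^2}{P}$ for $P>0$. In the half plane $P>0$ consider the profile system for the quantum hydrodynamics system with linear viscosity, $$P'=Q,\qquad Q'=\frac{2}{k^2}f(P)-\frac{2s\mu}{k^2}Q+\frac{Q^2}{P}.$$ A heteroclinic trajectory from $[P^-,0]$ to $[P^+,0]$ is a solution $(P,Q)$ defined on all of $\mathbb R$, with $P>0$, such that $(P,Q)(y)\to(P^\pm,0)$ as $y\to\pm\infty$. (i) If $s>0$ and $0<P^+<P^-$, then there exists a heteroclinic trajectory from $[P^-,0]$ to $[P^+,0]$.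 If in addition $\frac{s\mu}{k}<\sqrt{-2f'(P^+)}$, then for every such trajectory the profile $P$ is non-monotone (neither non-decreasing nor non-increasing on $\mathbb R$), and it oscillates about $P^+$ as $y\to+\infty$: for every $Y$ there are $y_1,y_2>Y$ with $P(y_1)<P^+<P(y_2)$. (ii) If $s<0$ and $0<P^-<P^+$, then there exists a heteroclinic trajectory from $[P^-,0]$ to $[P^+,0]$. If in addition $-\frac{s\mu}{k}<\sqrt{-2f'(P^-)}$, then for every such trajectory the profile $P$ is non-monotone, and it oscillates about $P^-$ as $y\to-\infty$: for every $Y$ there are $y_1,y_2<Y$ with $P(y_1)<P^-<P(y_2)$. -/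

import Mathlib

open Filter Topology

namespace QHD

/-- Rankine-Hugoniot conditions, with speed `s`, between the left state `(Pm, Jm)` and the right
state `(Pp, Jp)`, for the Euler system `ρ_t + m_x = 0`, `m_t + (m² / ρ + ρ ^ γ)_x = 0`. -/
structure RankineHugoniot (γ s Pm Jm Pp Jp : ℝ) : Prop where
  mass : Jp - Jm = s * (Pp - Pm)
  momentum : (Jp ^ 2 / Pp + Pp ^ γ) - (Jm ^ 2 / Pm + Pm ^ γ) = s * (Jp - Jm)

/-- The integration constant `A = s P - J`, computed from an end state `(P, J)`. -/
noncomputable def constA (s P J : ℝ) : ℝ := s * P - J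

/-- The integration constant `B = -s J + (J² / P + P ^ γ)`, computed from an end state `(P, J)`. -/
noncomputable def constB (γ s P J : ℝ) : ℝ := -s * J + (J ^ 2 / P + P ^ γ)

/-- `constA` does not depend on which of the two end states is used. -/
theorem RankineHugoniot.constA_eq {γ s Pm Jm Pp Jp : ℝ}
    (h : RankineHugoniot γ s Pm Jm Pp Jp) : constA s Pp Jp = constA s Pm Jm := by
  have := h.mass
  unfold constA
  linarith

/-- `constB` does not depend on which of the two end states is used. -/
theorem RankineHugoniot.constB_eq {γ s Pm Jm Pp Jp : ℝ}
    (h : RankineHugoniot γ s Pm Jm Pp Jp) : constB γ s Pp Jp = constB γ s Pm Jm := by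
  have := h.momentum
  unfold constB
  linarith

/-- The nonlinearity `f(p) = p ^ γ - (A s + B) + A² / p` (used for `p > 0`), where `A` and `B` are
computed from the end state `(P, J)`. -/
noncomputable def profileF (γ s P J : ℝ) (p : ℝ) : ℝ :=
  p ^ γ - (constA s P J * s + constB γ s P J) + constA s P J ^ 2 / p

/-- `(P, Q)` is a trajectory, defined on the whole line and contained in the half plane `P > 0`,
of the system `P' = Q`, `Q' = (2 / k²) f(P) - (2 s μ / k²) Q + Q² / P`. -/
structure IsTrajectory (f : ℝ → ℝ) (s μ k : ℝ) (P Q : ℝ → ℝ) : Prop where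
  pos : ∀ y, 0 < P y
  deriv_P : ∀ y, HasDerivAt P (Q y) y
  deriv_Q : ∀ y, HasDerivAt Q
    (2 / k ^ 2 * f (P y) - 2 * s * μ / k ^ 2 * Q y + Q y ^ 2 / P y) y

/-- `(P, Q)` is a trajectory that connects `[Pm, 0]` (as `y → -∞`) to `[Pp, 0]` (as `y → +∞`). -/
structure IsHeteroclinic (f : ℝ → ℝ) (s μ k Pm Pp : ℝ) (P Q : ℝ → ℝ) : Prop
    extends IsTrajectory f s μ k P Q where
  tendsto_atBot : Tendsto (fun y => (P y, Q y)) atBot (𝓝 (Pm, 0))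
  tendsto_atTop : Tendsto (fun y => (P y, Q y)) atTop (𝓝 (Pp, 0))

/-- The profile `P` is neither non-decreasing nor non-increasing. -/
def NonMonotone (P : ℝ → ℝ) : Prop := ¬ Monotone P ∧ ¬ Antitone P

/-- `P` oscillates about the value `c` along the filter `l` (`l = atTop` or `l = atBot`): it takes
values below `c` and values above `c` arbitrarily far out. -/
def OscillatesAbout (P : ℝ → ℝ) (c : ℝ) (l : Filter ℝ) : Prop :=
  (∃ᶠ y in l, P y < c) ∧ (∃ᶠ y in l, c < P y)

end QHD

/-! In the coordinates u = log P, v = Q / P the term Q² / P disappears and the profile system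
becomes u' = v, v' = g(u) - c v with c = 2sμ / k² and g(u) = (2 / k²) f(eᵘ) e⁻ᵘ. For s > 0 this is a
particle with friction in a potential V, V' = -g. Since p f(p) is strictly convex, its two zeros lo
< hi fix the sign of f: positive below lo, negative between. Thus V has a bottom at log lo and a top
at log hi; since A ≠ 0, it also has a wall on the left at least as high as the top
(`exists_potentialWell_force`).

Existence is a compactness argument. The force is frozen outside the well and the velocity
truncated, so that all motions are global. A particle released at rest just below the top needs
arbitrarily long to reach a fixed point m of the slope, because the top is an equilibrium. With the
clock reset at the passage through m, a subsequence of these motions converges to one that was on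
the slope at all negative times (`exists_motion_on_slope`). Its energy is monotone and bounded; by
Barbalat's lemma velocity and force vanish at both ends, so the motion joins the top to the bottom
(`PotentialWell.exists_connection`). The energy bound shows that neither modification was active.

For oscillation, the condition on sμ / k says that the linearisation at the bottom has complex
eigenvalues. By Sturm comparison (`eq_zero_of_oscillatory`) a solution that stays on one side of the
bottom is eventually equal to it, hence by uniqueness was there at all earlier times, contrary to
its limit at -∞. The case s < 0 follows by reversing time. -/

namespace QHD

open Set Metric

/-! ### Global flows and Barbalat's lemma -/

/-- A bounded, globally Lipschitz vector field has an integral curve, defined on the whole line,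
through every point. -/
theorem exists_global_integralCurve {E : Type*} [NormedAddCommGroup E] [NormedSpace ℝ E]
    [CompleteSpace E] {F : E → E} {K L : NNReal} (hF : LipschitzWith K F)
    (hL : ∀ x, ‖F x‖ ≤ L) (x : E) :
    ∃ α : ℝ → E, α 0 = x ∧ ∀ t, HasDerivAt α (F (α t)) t := by
  have local_sol : ∀ T : ℝ, 0 < T → ∃ α : ℝ → E, α 0 = x ∧
      ∀ t ∈ Ioo (-T) T, HasDerivAt α (F (α t)) t := by
    intro T hT
    have h0 : (0 : ℝ) ∈ Icc (-T) T := ⟨by linarith, hT.le⟩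
    -- A curve of speed at most L stays in the ball of radius L T during time T, so no smallness of
    -- T is needed.
    have hPL : IsPicardLindelof (fun _ : ℝ => F) (⟨0, h0⟩ : Icc (-T) T) x
        (L * T.toNNReal) 0 L K :=
      { lipschitzOnWith := fun _ _ => hF.lipschitzOnWith
        continuousOn := fun _ _ => continuousOn_const
        norm_le := fun _ _ y _ => hL y
        mul_max_le := by
          rw [NNReal.coe_mul, Real.coe_toNNReal T hT.le]
          simp }
    obtain ⟨α, hα0, hα⟩ := hPL.exists_eq_forall_mem_Icc_hasDerivWithinAt₀
    exact ⟨α, hα0, fun t ht =>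
      (hα t (Ioo_subset_Icc_self ht)).hasDerivAt (Icc_mem_nhds ht.1 ht.2)⟩
  choose! α hα0 hα using local_sol
  have agree : ∀ S T : ℝ, 0 < S → S ≤ T → ∀ t ∈ Ioo (-S) S, α S t = α T t := by
    intro S T hS hST
    refine ODE_solution_unique_of_mem_Ioo (v := fun _ => F) (s := fun _ => univ) (K := K)
      (t₀ := 0) (fun _ _ => hF.lipschitzOnWith) ⟨by linarith, hS⟩
      (fun t ht => ⟨hα S hS t ht, trivial⟩)
      (fun t ht => ⟨hα T (hS.trans_le hST) t ⟨by linarith [ht.1], by linarith [ht.2]⟩, trivial⟩) ?_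
    rw [hα0 S hS, hα0 T (hS.trans_le hST)]
  have mem : ∀ t : ℝ, t ∈ Ioo (-(|t| + 1)) (|t| + 1) := fun t =>
    ⟨by linarith [neg_abs_le t], by linarith [le_abs_self t]⟩
  -- The value at t comes from a solution whose interval contains t. Near t all of these agree with
  -- the solution on the interval of radius |t| + 2.
  refine ⟨fun t => α (|t| + 1) t, hα0 _ (by positivity), fun t => ?_⟩
  have hev : (fun τ => α (|τ| + 1) τ) =ᶠ[𝓝 t] α (|t| + 2) := by
    have : ∀ᶠ τ in 𝓝 t, |τ| < |t| + 1 :=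
      continuous_abs.continuousAt.eventually_lt continuousAt_const (by linarith)
    filter_upwards [this] with τ hτ
    exact agree _ _ (by positivity) (by linarith) τ (mem τ)
  have hd := hα (|t| + 2) (by positivity) t
    ⟨by linarith [neg_abs_le t], by linarith [le_abs_self t]⟩
  have ht : α (|t| + 1) t = α (|t| + 2) t :=
    agree _ _ (by positivity) (by linarith) t (mem t)
  simpa only [ht] using hd.congr_of_eventuallyEq hev

/-- Time reversal of an integral curve. -/
theorem hasDerivAt_comp_neg_of {E : Type*} [NormedAddCommGroup E] [NormedSpace ℝ E] {α : ℝ → E}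
    {t : ℝ} {e : E} (h : HasDerivAt α e (-t)) : HasDerivAt (fun τ => α (-τ)) (-e) t := by
  simpa [Function.comp_def] using h.scomp t (hasDerivAt_neg t)

/-- Continuous dependence of global integral curves on the initial value. -/
theorem dist_integralCurve_le {E : Type*} [NormedAddCommGroup E] [NormedSpace ℝ E]
    {F : E → E} {K : NNReal} (hF : LipschitzWith K F) {α β : ℝ → E}
    (hα : ∀ t, HasDerivAt α (F (α t)) t) (hβ : ∀ t, HasDerivAt β (F (β t)) t) (t : ℝ) :
    dist (α t) (β t) ≤ dist (α 0) (β 0) * Real.exp (K * |t|) := by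
  have forward : ∀ (F : E → E) (α β : ℝ → E), LipschitzWith K F →
      (∀ t, HasDerivAt α (F (α t)) t) → (∀ t, HasDerivAt β (F (β t)) t) → ∀ t, 0 ≤ t →
      dist (α t) (β t) ≤ dist (α 0) (β 0) * Real.exp (K * t) := by
    intro F α β hF hα hβ t ht
    have := dist_le_of_trajectories_ODE (v := fun _ => F) (K := K) (a := 0) (b := t)
      (fun _ => hF) (fun s _ => (hα s).continuousAt.continuousWithinAt)
      (fun s _ => (hα s).hasDerivWithinAt)
      (fun s _ => (hβ s).continuousAt.continuousWithinAt)
      (fun s _ => (hβ s).hasDerivWithinAt) le_rfl t ⟨ht, le_rfl⟩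
    simpa using this
  rcases le_total 0 t with ht | ht
  · rw [abs_of_nonneg ht]
    exact forward F α β hF hα hβ t ht
  · rw [abs_of_nonpos ht]
    have := forward (fun x => -F x) (fun s => α (-s)) (fun s => β (-s)) hF.neg
      (fun s => hasDerivAt_comp_neg_of (hα (-s)))
      (fun s => hasDerivAt_comp_neg_of (hβ (-s))) (-t) (by linarith)
    simpa using this

/-- Barbalat's lemma: if `h` converges at `+∞` and `h'` is uniformly continuous, then `h' → 0`. -/
theorem tendsto_deriv_zero_of_tendsto {h h' : ℝ → ℝ} {l : ℝ}
    (hd : ∀ y, HasDerivAt h (h' y) y) (huc : UniformContinuous h')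
    (hl : Tendsto h atTop (𝓝 l)) : Tendsto h' atTop (𝓝 0) := by
  rw [Metric.tendsto_nhds]
  intro ε hε
  obtain ⟨δ, hδ, hδ'⟩ := Metric.uniformContinuous_iff.1 huc (ε / 2) (by positivity)
  have hdiff : Tendsto (fun y => h (y + δ / 2) - h y) atTop (𝓝 0) := by
    simpa using (hl.comp (tendsto_atTop_add_const_right _ (δ / 2) tendsto_id)).sub hl
  filter_upwards [Metric.tendsto_nhds.1 hdiff (δ / 2 * (ε / 2)) (by positivity)] with y hy
  obtain ⟨ξ, hξ, hξ'⟩ := exists_hasDerivAt_eq_slope h h' (show y < y + δ / 2 by linarith)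
    (fun s _ => (hd s).continuousAt.continuousWithinAt) (fun s _ => hd s)
  have h1 : dist (h' y) (h' ξ) < ε / 2 := by
    apply hδ'
    rw [Real.dist_eq, abs_lt]
    constructor <;> linarith [hξ.1, hξ.2]
  have h2 : |h' ξ| < ε / 2 := by
    rw [hξ', add_sub_cancel_left, abs_div, abs_of_pos (show 0 < δ / 2 by linarith), div_lt_iff₀
      (by linarith)]
    rw [dist_zero_right, Real.norm_eq_abs] at hy
    linarith
  rw [Real.dist_eq] at h1
  rw [dist_zero_right, Real.norm_eq_abs]
  have := abs_add_le (h' y - h' ξ) (h' ξ)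
  rw [sub_add_cancel] at this
  linarith

/-- A function with values in a compact set along which `G` tends to zero converges to the only
zero of `G` in this set. -/
theorem tendsto_of_tendsto_zero_of_unique_zero {ι : Type*} {l : Filter ι} {S : Set ℝ}
    {G : ℝ → ℝ} {u : ι → ℝ} {p : ℝ} (hS : IsCompact S) (hG : Continuous G)
    (hu : ∀ᶠ y in l, u y ∈ S) (h0 : Tendsto (fun y => G (u y)) l (𝓝 0))
    (huniq : ∀ x ∈ S, G x = 0 → x = p) : Tendsto u l (𝓝 p) := by
  refine hS.tendsto_nhds_of_unique_mapClusterPt hu fun x hx hxc => huniq x hx ?_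
  have h1 : MapClusterPt (G x) l (fun y => G (u y)) :=
    hxc.continuousAt_comp hG.continuousAt
  have h2 : ClusterPt (G x) (𝓝 0) := ClusterPt.mono h1 h0
  exact eq_of_nhds_neBot h2

/-- A function with nonnegative derivative is nondecreasing. -/
theorem le_of_hasDerivAt_nonneg {f f' : ℝ → ℝ} (hf : ∀ t, HasDerivAt f (f' t) t) {x y : ℝ}
    (hxy : x ≤ y) (h : ∀ t ∈ Ioo x y, 0 ≤ f' t) : f x ≤ f y := by
  refine monotoneOn_of_deriv_nonneg (convex_Icc x y)
    (fun t _ => (hf t).continuousAt.continuousWithinAt)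
    (fun t _ => (hf t).differentiableAt.differentiableWithinAt) (fun t ht => ?_)
    (left_mem_Icc.2 hxy) (right_mem_Icc.2 hxy) hxy
  rw [interior_Icc] at ht
  rw [(hf t).deriv]
  exact h t ht

/-- A function with positive derivative is increasing. -/
theorem lt_of_hasDerivAt_pos {f f' : ℝ → ℝ} (hf : ∀ t, HasDerivAt f (f' t) t) {x y : ℝ}
    (hxy : x < y) (h : ∀ t ∈ Ioo x y, 0 < f' t) : f x < f y := by
  refine strictMonoOn_of_deriv_pos (convex_Icc x y)
    (fun t _ => (hf t).continuousAt.continuousWithinAt) (fun t ht => ?_)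
    (left_mem_Icc.2 hxy.le) (right_mem_Icc.2 hxy.le) hxy
  rw [interior_Icc] at ht
  rw [(hf t).deriv]
  exact h t ht

/-! ### Truncated velocity and its kinetic energy -/

/-- Truncation of `v` to the interval `[-M, M]`. -/
noncomputable def truncate (M v : ℝ) : ℝ := max (-M) (min M v)

theorem lipschitzWith_truncate (M : ℝ) : LipschitzWith 1 (truncate M) :=
  (LipschitzWith.id.const_min M).const_max (-M)

theorem abs_truncate_le {M : ℝ} (hM : 0 < M) (v : ℝ) : |truncate M v| ≤ M := by
  unfold truncate
  rw [abs_le]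
  exact ⟨le_max_left _ _, max_le (by linarith) (min_le_left _ _)⟩

theorem truncate_of_abs_le {M v : ℝ} (h : |v| ≤ M) : truncate M v = v := by
  rw [abs_le] at h
  unfold truncate
  rw [min_eq_right h.2, max_eq_right h.1]

theorem truncate_nonneg {M v : ℝ} (hM : 0 < M) (hv : 0 ≤ v) : 0 ≤ truncate M v :=
  le_max_of_le_right (le_min hM.le hv)

theorem truncate_nonpos {M v : ℝ} (hM : 0 < M) (hv : v ≤ 0) : truncate M v ≤ 0 :=
  max_le (by linarith) (min_le_of_right_le hv)

theorem abs_le_of_abs_truncate_lt {M v : ℝ} (h : |truncate M v| < M) : |v| ≤ M := by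
  unfold truncate at h
  rw [abs_lt] at h
  rw [abs_le]
  constructor
  · by_contra hv
    push Not at hv
    exact absurd h.1 (not_lt.2 (max_le le_rfl (min_le_of_right_le hv.le)))
  · by_contra hv
    push Not at hv
    rw [min_eq_left hv.le] at h
    exact absurd (lt_of_le_of_lt (le_max_right _ _) h.2) (lt_irrefl _)

/-- The kinetic energy that belongs to the truncated velocity. -/
noncomputable def kinetic (M v : ℝ) : ℝ := ∫ t in (0 : ℝ)..v, truncate M t

theorem hasDerivAt_kinetic (M v : ℝ) : HasDerivAt (kinetic M) (truncate M v) v :=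
  intervalIntegral.integral_hasDerivAt_right
    ((lipschitzWith_truncate M).continuous.intervalIntegrable _ _)
    ((lipschitzWith_truncate M).continuous.stronglyMeasurableAtFilter _ _)
    (lipschitzWith_truncate M).continuous.continuousAt

theorem kinetic_zero (M : ℝ) : kinetic M 0 = 0 := by simp [kinetic]

theorem kinetic_le_of_nonneg {M v w : ℝ} (hM : 0 < M) (hv : 0 ≤ v) (hvw : v ≤ w) :
    kinetic M v ≤ kinetic M w :=
  le_of_hasDerivAt_nonneg (hasDerivAt_kinetic M) hvw
    fun _ ht => truncate_nonneg hM (hv.trans ht.1.le)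

theorem kinetic_le_of_nonpos {M v w : ℝ} (hM : 0 < M) (hv : v ≤ 0) (hvw : w ≤ v) :
    kinetic M v ≤ kinetic M w := by
  have := le_of_hasDerivAt_nonneg (fun t => (hasDerivAt_kinetic M t).neg) hvw
    fun _ ht => neg_nonneg.2 (truncate_nonpos hM (ht.2.le.trans hv))
  simpa using this

theorem kinetic_nonneg {M : ℝ} (hM : 0 < M) (v : ℝ) : 0 ≤ kinetic M v := by
  rcases le_total 0 v with hv | hv
  · exact (kinetic_zero M).symm.le.trans (kinetic_le_of_nonneg hM le_rfl hv)
  · exact (kinetic_zero M).symm.le.trans (kinetic_le_of_nonpos hM le_rfl hv)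

/-- The kinetic energy equals v² / 2 on [-M, M] and grows with |v|. Hence an energy bound below M² /
2 makes the truncation inactive. -/
theorem abs_le_of_kinetic_lt {M v : ℝ} (hM : 0 < M) (h : kinetic M v < M ^ 2 / 2) : |v| ≤ M := by
  have hd : ∀ t, HasDerivAt (fun t => kinetic M t - t ^ 2 / 2) (truncate M t - t) t := fun t => by
    exact ((hasDerivAt_kinetic M t).fun_sub ((hasDerivAt_pow 2 t).div_const 2)).congr_deriv
      (by simp)
  rw [abs_le]
  constructor
  · by_contra hv
    push Not at hv
    have h1 := kinetic_le_of_nonpos hM (by linarith) hv.le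
    have h2 := le_of_hasDerivAt_nonneg (fun t => (hd t).neg) (show -M ≤ 0 by linarith) fun t ht => by
      rw [truncate_of_abs_le (abs_le.2 ⟨ht.1.le, by linarith [ht.2]⟩)]
      simp
    simp only [Pi.neg_apply, kinetic_zero] at h2
    nlinarith
  · by_contra hv
    push Not at hv
    have h1 := kinetic_le_of_nonneg hM hM.le hv.le
    have h2 := le_of_hasDerivAt_nonneg hd (show 0 ≤ M by linarith) fun t ht => by
      rw [truncate_of_abs_le (abs_le.2 ⟨by linarith [ht.1], ht.2.le⟩)]
      simp
    simp only [kinetic_zero] at h2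
    nlinarith

/-! ### Potential wells -/

/-- The potential `V`, with force `G = -V'`, has a well with bottom `b`, bounded on the left by a
wall at `a` and on the right by the plateau `[d, ∞)`. -/
structure PotentialWell (G V : ℝ → ℝ) (a b d : ℝ) : Prop where
  hasDerivAt : ∀ u, HasDerivAt V (-G u) u
  left_lt : a < b
  lt_right : b < d
  pos : ∀ u, u < b → 0 < G u
  zero_bottom : G b = 0
  neg : ∀ u, b < u → u < d → G u < 0
  zero_plateau : ∀ u, d ≤ u → G u = 0
  wall : V d ≤ V a

namespace PotentialWell

variable {G V : ℝ → ℝ} {a b d : ℝ}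

theorem bottom_le (h : PotentialWell G V a b d) (u : ℝ) : V b ≤ V u := by
  rcases le_total u b with hu | hu
  · have := le_of_hasDerivAt_nonneg (fun t => (h.hasDerivAt t).neg) hu fun t ht => by
      have := h.pos t ht.2
      linarith
    simpa using this
  · refine le_of_hasDerivAt_nonneg h.hasDerivAt hu fun t ht => ?_
    rcases lt_or_ge t d with htd | htd
    · have := h.neg t ht.1 htd
      linarith
    · rw [h.zero_plateau t htd, neg_zero]

theorem lt_plateau (h : PotentialWell G V a b d) {x : ℝ} (hb : b ≤ x) (hd : x < d) : V x < V d :=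
  lt_of_hasDerivAt_pos h.hasDerivAt hd fun t ht => by
    have := h.neg t (hb.trans_lt ht.1) ht.2
    linarith

/-- V decreases up to the wall, which is at least as high as the plateau, and is constant beyond d.
Motions with energy below the plateau are therefore trapped. -/
theorem mem_Ioo_of_lt (h : PotentialWell G V a b d) {x : ℝ} (hx : V x < V d) : x ∈ Ioo a d := by
  constructor
  · by_contra hxa
    push Not at hxa
    have := le_of_hasDerivAt_nonneg (fun t => (h.hasDerivAt t).neg) hxa fun t ht => by
      have := h.pos t (ht.2.trans h.left_lt)
      linarith
    simp only [Pi.neg_apply] at this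
    linarith [h.wall]
  · by_contra hxd
    push Not at hxd
    have := le_of_hasDerivAt_nonneg h.hasDerivAt hxd fun t ht => by
      rw [h.zero_plateau t ht.1.le, neg_zero]
    linarith

theorem eq_or_eq_of_zero (h : PotentialWell G V a b d) {x : ℝ} (hx : x ≤ d) (h0 : G x = 0) :
    x = b ∨ x = d := by
  rcases lt_trichotomy x b with hb | hb | hb
  · exact absurd h0 (h.pos x hb).ne'
  · exact Or.inl hb
  · rcases hx.lt_or_eq with hd | hd
    · exact absurd h0 (h.neg x hb hd).ne
    · exact Or.inr hd

end PotentialWell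

/-! ### Damped motion and energy dissipation -/

/-- `(u, v)` solves `u' = v`, `v' = G(u) - c v` with the velocity truncated to `[-M, M]`. -/
def IsTruncatedMotion (G : ℝ → ℝ) (c M : ℝ) (u v : ℝ → ℝ) : Prop :=
  ∀ y, HasDerivAt u (truncate M (v y)) y ∧
    HasDerivAt v (G (u y) - c * truncate M (v y)) y

/-- The vector field of the truncated system. -/
noncomputable def truncatedField (G : ℝ → ℝ) (c M : ℝ) (x : ℝ × ℝ) : ℝ × ℝ :=
  (truncate M x.2, G x.1 - c * truncate M x.2)

theorem exists_lipschitzWith_truncatedField {G : ℝ → ℝ} {KG : NNReal} (hG : LipschitzWith KG G)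
    (c M : ℝ) : ∃ K, LipschitzWith K (truncatedField G c M) := by
  have h1 : LipschitzWith (1 * 1) (fun x : ℝ × ℝ => truncate M x.2) :=
    (lipschitzWith_truncate M).comp LipschitzWith.prod_snd
  have h2 : LipschitzWith (‖c‖₊ * (1 * 1)) (fun x : ℝ × ℝ => c * truncate M x.2) :=
    (lipschitzWith_smul c).comp h1
  exact ⟨_, h1.prodMk ((hG.comp LipschitzWith.prod_fst).sub h2)⟩

theorem exists_norm_truncatedField_le {G : ℝ → ℝ} {L : ℝ} (hL : ∀ u, |G u| ≤ L) (c : ℝ) {M : ℝ}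
    (hM : 0 < M) : ∃ B : NNReal, ∀ x, ‖truncatedField G c M x‖ ≤ B := by
  refine ⟨(max M (L + |c| * M)).toNNReal, fun x => ?_⟩
  rw [Real.coe_toNNReal _ (le_max_of_le_left hM.le)]
  refine max_le_max (abs_truncate_le hM _) ?_
  refine (norm_sub_le _ _).trans (add_le_add (hL _) ?_)
  rw [norm_mul]
  exact mul_le_mul_of_nonneg_left (abs_truncate_le hM _) (abs_nonneg c)

theorem IsTruncatedMotion.hasDerivAt_prodMk {G : ℝ → ℝ} {c M : ℝ} {u v : ℝ → ℝ}
    (h : IsTruncatedMotion G c M u v) (y : ℝ) :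
    HasDerivAt (fun t => (u t, v t)) (truncatedField G c M (u y, v y)) y :=
  (h y).1.prodMk (h y).2

theorem exists_isTruncatedMotion {G : ℝ → ℝ} {KG : NNReal} {L : ℝ} (hG : LipschitzWith KG G)
    (hL : ∀ u, |G u| ≤ L) (c : ℝ) {M : ℝ} (hM : 0 < M) (u₀ v₀ : ℝ) :
    ∃ u v : ℝ → ℝ, u 0 = u₀ ∧ v 0 = v₀ ∧ IsTruncatedMotion G c M u v := by
  obtain ⟨K, hK⟩ := exists_lipschitzWith_truncatedField hG c M
  obtain ⟨B, hB⟩ := exists_norm_truncatedField_le hL c hM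
  obtain ⟨α, hα0, hα⟩ := exists_global_integralCurve hK hB (u₀, v₀)
  refine ⟨fun t => (α t).1, fun t => (α t).2, by simp [hα0], by simp [hα0], fun y => ⟨?_, ?_⟩⟩
  · exact (hα y).fst
  · exact (hα y).snd

/-- The total energy of a truncated motion. -/
noncomputable def energy (V : ℝ → ℝ) (M : ℝ) (u v : ℝ → ℝ) (y : ℝ) : ℝ :=
  kinetic M (v y) + V (u y)

theorem IsTruncatedMotion.hasDerivAt_energy {G V : ℝ → ℝ} {c M : ℝ} {u v : ℝ → ℝ}
    (h : IsTruncatedMotion G c M u v) (hV : ∀ u, HasDerivAt V (-G u) u) (y : ℝ) :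
    HasDerivAt (energy V M u v) (-(c * truncate M (v y) ^ 2)) y := by
  have : HasDerivAt (energy V M u v) _ y :=
    ((hasDerivAt_kinetic M (v y)).comp y (h y).2).add ((hV (u y)).comp y (h y).1)
  exact this.congr_deriv (by ring)

theorem IsTruncatedMotion.energy_antitone {G V : ℝ → ℝ} {c M : ℝ} {u v : ℝ → ℝ}
    (h : IsTruncatedMotion G c M u v) (hV : ∀ u, HasDerivAt V (-G u) u) (hc : 0 ≤ c) :
    Antitone (energy V M u v) := fun x y hxy => by
  have := le_of_hasDerivAt_nonneg (fun t => (h.hasDerivAt_energy hV t).neg) hxy fun t _ => by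
    have := mul_nonneg hc (sq_nonneg (truncate M (v t)))
    linarith
  simpa using this

/-- Barbalat's lemma at either end of the line. -/
theorem tendsto_deriv_zero_of_tendsto_end {h h' : ℝ → ℝ} {x : ℝ} {l : Filter ℝ}
    (hend : l = atTop ∨ l = atBot) (hd : ∀ y, HasDerivAt h (h' y) y)
    (huc : UniformContinuous h') (hl : Tendsto h l (𝓝 x)) : Tendsto h' l (𝓝 0) := by
  rcases hend with rfl | rfl
  · exact tendsto_deriv_zero_of_tendsto hd huc hl
  · have := tendsto_deriv_zero_of_tendsto (fun y => hasDerivAt_comp_neg_of (hd (-y)))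
      (huc.comp uniformContinuous_neg).neg (hl.comp tendsto_neg_atTop_atBot)
    have := (this.comp tendsto_neg_atBot_atTop).neg
    simpa [Function.comp_def] using this

theorem uniformContinuous_of_abs_deriv_le {h h' : ℝ → ℝ} {B : NNReal}
    (hd : ∀ y, HasDerivAt h (h' y) y) (hB : ∀ y, |h' y| ≤ B) : UniformContinuous h :=
  (lipschitzWith_of_nnnorm_deriv_le (C := B) (fun y => (hd y).differentiableAt) fun y => by
    rw [(hd y).deriv, ← NNReal.coe_le_coe, coe_nnnorm]
    exact hB y).uniformContinuous

section

variable {G V : ℝ → ℝ} {a b d c M L : ℝ} {KG : NNReal} {u v : ℝ → ℝ} {l : Filter ℝ}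

theorem uniformContinuous_truncate_sq (hM : 0 < M) :
    UniformContinuous fun x => truncate M x ^ 2 := by
  have : LipschitzWith (2 * M).toNNReal fun x => truncate M x ^ 2 := by
    refine LipschitzWith.of_dist_le_mul fun x y => ?_
    rw [Real.coe_toNNReal _ (by positivity), Real.dist_eq, sq_sub_sq, abs_mul]
    have h1 := (lipschitzWith_truncate M).dist_le_mul x y
    rw [Real.dist_eq, NNReal.coe_one, one_mul] at h1
    have h2 := abs_add_le (truncate M x) (truncate M y)
    have h3 := abs_truncate_le hM x
    have h4 := abs_truncate_le hM y
    exact mul_le_mul (by linarith) h1 (abs_nonneg _) (by positivity)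
  exact this.uniformContinuous

theorem IsTruncatedMotion.uniformContinuous (h : IsTruncatedMotion G c M u v)
    (hL : ∀ u, |G u| ≤ L) (hM : 0 < M) : UniformContinuous u ∧ UniformContinuous v := by
  obtain ⟨B, hB⟩ := exists_norm_truncatedField_le hL c hM
  exact ⟨uniformContinuous_of_abs_deriv_le (fun y => (h y).1)
      fun y => (norm_fst_le _).trans (hB (u y, v y)),
    uniformContinuous_of_abs_deriv_le (fun y => (h y).2)
      fun y => (norm_snd_le _).trans (hB (u y, v y))⟩

/-- If the energy converges at an end of the line, then velocity and force vanish there. -/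
theorem IsTruncatedMotion.tendsto_zero (h : IsTruncatedMotion G c M u v)
    (hV : ∀ u, HasDerivAt V (-G u) u) (hG : LipschitzWith KG G) (hL : ∀ u, |G u| ≤ L)
    (hM : 0 < M) (hc : 0 < c) (hend : l = atTop ∨ l = atBot) {e : ℝ}
    (he : Tendsto (energy V M u v) l (𝓝 e)) :
    Tendsto v l (𝓝 0) ∧ Tendsto (fun y => G (u y)) l (𝓝 0) := by
  obtain ⟨huu, huv⟩ := h.uniformContinuous hL hM
  -- Barbalat for the energy, whose derivative is -c times the squared truncated velocity. Applied
  -- again to v, it gives v' → 0 and hence G(u) → 0.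
  have h1 : Tendsto (fun y => -(c * truncate M (v y) ^ 2)) l (𝓝 0) :=
    tendsto_deriv_zero_of_tendsto_end hend (h.hasDerivAt_energy hV)
      ((lipschitzWith_smul c).uniformContinuous.comp
        ((uniformContinuous_truncate_sq hM).comp huv)).neg he
  have h2 : Tendsto (fun y => truncate M (v y)) l (𝓝 0) := by
    have h3 : Tendsto (fun y => truncate M (v y) ^ 2) l (𝓝 0) := by
      have := h1.const_mul (-c⁻¹)
      rw [mul_zero] at this
      refine this.congr fun y => ?_
      field_simp
    have h4 := h3.sqrt
    simp only [Real.sqrt_sq_eq_abs, Real.sqrt_zero] at h4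
    exact (tendsto_zero_iff_abs_tendsto_zero _).2 h4
  have h5 : Tendsto v l (𝓝 0) := by
    refine h2.congr' ?_
    filter_upwards [Metric.tendsto_nhds.1 h2 M hM] with y hy
    rw [dist_zero_right, Real.norm_eq_abs] at hy
    exact truncate_of_abs_le (abs_le_of_abs_truncate_lt hy)
  refine ⟨h5, ?_⟩
  have h6 : Tendsto (fun y => G (u y) - c * truncate M (v y)) l (𝓝 0) :=
    tendsto_deriv_zero_of_tendsto_end hend (fun y => (h y).2)
      ((hG.uniformContinuous.comp huu).sub ((lipschitzWith_smul c).uniformContinuous.comp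
        ((lipschitzWith_truncate M).uniformContinuous.comp huv))) h5
  simpa using h6.add (h2.const_mul c)

/-- A motion whose energy drops below the plateau comes to rest at the bottom of the well. -/
theorem IsTruncatedMotion.tendsto_bottom (h : IsTruncatedMotion G c M u v)
    (hw : PotentialWell G V a b d) (hG : LipschitzWith KG G) (hL : ∀ u, |G u| ≤ L)
    (hM : 0 < M) (hc : 0 < c) {y₀ : ℝ} (hy₀ : energy V M u v y₀ < V d) :
    Tendsto u atTop (𝓝 b) ∧ Tendsto v atTop (𝓝 0) := by
  have hanti := h.energy_antitone hw.hasDerivAt hc.le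
  have hbdd : BddBelow (range (energy V M u v)) := by
    refine ⟨V b, ?_⟩
    rintro _ ⟨y, rfl⟩
    have h1 := kinetic_nonneg hM (v y)
    have h2 := hw.bottom_le (u y)
    unfold energy
    linarith
  obtain ⟨hv0, hG0⟩ := h.tendsto_zero hw.hasDerivAt hG hL hM hc (Or.inl rfl)
    (tendsto_atTop_ciInf hanti hbdd)
  refine ⟨?_, hv0⟩
  have hVc : Continuous V := continuous_iff_continuousAt.2 fun x => (hw.hasDerivAt x).continuousAt
  -- The sublevel set of V excludes the zero d of the force, so that b is the only possible limit.
  refine tendsto_of_tendsto_zero_of_unique_zero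
    (S := Icc a d ∩ {x | V x ≤ energy V M u v y₀})
    (isCompact_Icc.inter_right (isClosed_le hVc continuous_const)) hG.continuous ?_ hG0 ?_
  · filter_upwards [eventually_ge_atTop y₀] with y hy
    have h1 : V (u y) ≤ energy V M u v y₀ := by
      have h2 := kinetic_nonneg hM (v y)
      have h3 := hanti hy
      unfold energy at h3 ⊢
      linarith
    exact ⟨Ioo_subset_Icc_self (hw.mem_Ioo_of_lt (h1.trans_lt hy₀)), h1⟩
  · rintro x ⟨hx, hxV⟩ hx0
    rcases hw.eq_or_eq_of_zero hx.2 hx0 with rfl | rfl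
    · rfl
    · exact absurd (lt_of_le_of_lt hxV hy₀) (lt_irrefl _)

/-- A motion that stays on the right slope of the well for negative times, with bounded energy,
starts at the top of the slope. -/
theorem IsTruncatedMotion.tendsto_plateau (h : IsTruncatedMotion G c M u v)
    (hw : PotentialWell G V a b d) (hG : LipschitzWith KG G) (hL : ∀ u, |G u| ≤ L)
    (hM : 0 < M) (hc : 0 < c) {m : ℝ} (hm : b < m) (hu : ∀ y ≤ 0, u y ∈ Icc m d)
    (hE : ∀ y, energy V M u v y ≤ V d) :
    Tendsto u atBot (𝓝 d) ∧ Tendsto v atBot (𝓝 0) := by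
  have hanti := h.energy_antitone hw.hasDerivAt hc.le
  have hbdd : BddAbove (range (energy V M u v)) := by
    refine ⟨V d, ?_⟩
    rintro _ ⟨y, rfl⟩
    exact hE y
  obtain ⟨hv0, hG0⟩ := h.tendsto_zero hw.hasDerivAt hG hL hM hc (Or.inr rfl)
    (tendsto_atBot_ciSup hanti hbdd)
  refine ⟨?_, hv0⟩
  refine tendsto_of_tendsto_zero_of_unique_zero (S := Icc m d) isCompact_Icc hG.continuous
    ?_ hG0 ?_
  · filter_upwards [eventually_le_atBot 0] with y hy using hu y hy
  · rintro x hx hx0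
    rcases hw.eq_or_eq_of_zero hx.2 hx0 with rfl | rfl
    · exact absurd (hm.trans_le hx.1) (lt_irrefl _)
    · rfl

/-! ### The connecting orbit as a limit -/

/-- For every `T` there is a motion that passes a point `m` of the right slope at time zero, has
stayed to the right of `m` since time `-T`, and has energy below the plateau. -/
theorem exists_motion_from_slope (hw : PotentialWell G V a b d) (hG : LipschitzWith KG G)
    (hL : ∀ u, |G u| ≤ L) (hM : 0 < M) (hc : 0 < c) {m : ℝ} (hm : b < m) (hmd : m < d) (T : ℝ) :
    ∃ u v : ℝ → ℝ, IsTruncatedMotion G c M u v ∧ u 0 = m ∧ (∀ y ∈ Icc (-T) 0, m ≤ u y) ∧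
      ∀ y, -T ≤ y → energy V M u v y < V d := by
  obtain ⟨K, hK⟩ := exists_lipschitzWith_truncatedField hG c M
  -- By continuous dependence, a motion starting within ε of the equilibrium (d, 0) cannot reach m
  -- before time T.
  obtain ⟨ε, hε, hεT⟩ : ∃ ε > 0, ε * Real.exp (K * T) < d - m := by
    refine ⟨(d - m) / (2 * Real.exp (K * T)), div_pos (by linarith) (by positivity), ?_⟩
    rw [div_mul_eq_mul_div, mul_div_mul_right _ _ (Real.exp_pos _).ne']
    linarith
  set x := max (d - ε) ((m + d) / 2) with hx
  have hxm : m < x := lt_max_of_lt_right (by linarith)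
  have hxd : x < d := max_lt (by linarith) (by linarith)
  have hxε : d - x ≤ ε := by linarith [le_max_left (d - ε) ((m + d) / 2)]
  obtain ⟨u, v, hu0, hv0, h⟩ := exists_isTruncatedMotion hG hL c hM x 0
  have hE0 : energy V M u v 0 < V d := by
    unfold energy
    rw [hu0, hv0, kinetic_zero, zero_add]
    exact hw.lt_plateau (hm.trans hxm).le hxd
  have huc : Continuous u := continuous_iff_continuousAt.2 fun y => (h y).1.continuousAt
  obtain ⟨hub, -⟩ := h.tendsto_bottom hw hG hL hM hc hE0
  set S := {y | 0 ≤ y ∧ u y ≤ m} with hS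
  have hSc : IsClosed S :=
    (isClosed_le continuous_const continuous_id).inter (isClosed_le huc continuous_const)
  have hSn : S.Nonempty := by
    obtain ⟨y, hy⟩ := ((hub.eventually_lt_const hm).and (eventually_ge_atTop 0)).exists
    exact ⟨y, hy.2, hy.1.le⟩
  have hSb : BddBelow S := ⟨0, fun y hy => hy.1⟩
  -- The infimum τ is the first passage through m; it becomes the new time origin.
  obtain ⟨hτ0, hτm⟩ : sInf S ∈ S := hSc.csInf_mem hSn hSb
  have hmin : ∀ y ∈ S, sInf S ≤ y := fun y hy => csInf_le hSb hy
  generalize sInf S = τ at hτ0 hτm hmin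
  have huτ : u τ = m := by
    obtain ⟨y, hy, hym⟩ := intermediate_value_Icc' hτ0 huc.continuousOn
      (show m ∈ Icc (u τ) (u 0) from ⟨hτm, by rw [hu0]; exact hxm.le⟩)
    rw [← le_antisymm hy.2 (hmin y ⟨hy.1, hym.le⟩)]
    exact hym
  have hTτ : T < τ := by
    by_contra hTτ
    push Not at hTτ
    have hconst : ∀ t : ℝ, HasDerivAt (fun _ : ℝ => (d, (0 : ℝ)))
        (truncatedField G c M (d, 0)) t := fun t => by
      have : truncatedField G c M (d, 0) = 0 := by
        unfold truncatedField
        rw [truncate_of_abs_le (by simpa using hM.le), hw.zero_plateau d le_rfl]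
        simp
      rw [this]
      exact hasDerivAt_const _ _
    have h1 := dist_integralCurve_le hK h.hasDerivAt_prodMk hconst τ
    rw [hu0, hv0, Prod.dist_eq, Prod.dist_eq, dist_self, abs_of_nonneg hτ0, Real.dist_eq x d,
      abs_sub_comm, abs_of_pos (sub_pos.2 hxd), max_eq_left (sub_pos.2 hxd).le] at h1
    have h2 := (le_max_left _ _).trans h1
    rw [huτ, Real.dist_eq, abs_sub_comm, abs_of_pos (sub_pos.2 hmd)] at h2
    have h3 : (d - x) * Real.exp (K * τ) ≤ ε * Real.exp (K * T) := by gcongr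
    linarith
  refine ⟨fun y => u (y + τ), fun y => v (y + τ), fun y =>
    ⟨(h (y + τ)).1.comp_add_const y τ, (h (y + τ)).2.comp_add_const y τ⟩, by simpa using huτ,
    fun y hy => ?_, fun y hy => ?_⟩
  · rcases hy.2.lt_or_eq with hy0 | rfl
    · by_contra hlt
      push Not at hlt
      have := hmin (y + τ) ⟨by linarith [hy.1], hlt.le⟩
      linarith
    · simp [huτ]
  · exact lt_of_le_of_lt (h.energy_antitone hw.hasDerivAt hc.le
      (show 0 ≤ y + τ by linarith)) hE0

/-- Bounds on position and velocity of a motion with energy below the plateau. -/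
theorem PotentialWell.bounds_of_energy_lt (hw : PotentialWell G V a b d) (hM : 0 < M)
    (hMd : V d - V b < M ^ 2 / 2) {y : ℝ} (hE : energy V M u v y < V d) :
    u y ∈ Icc a d ∧ |v y| ≤ M := by
  unfold energy at hE
  have h1 := kinetic_nonneg hM (v y)
  have h2 := hw.bottom_le (u y)
  exact ⟨Ioo_subset_Icc_self (hw.mem_Ioo_of_lt (by linarith)),
    abs_le_of_kinetic_lt hM (by linarith)⟩

/-- There is a motion with energy at most that of the plateau which has been on the right slope
at all negative times. -/
theorem exists_motion_on_slope (hw : PotentialWell G V a b d) (hG : LipschitzWith KG G)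
    (hL : ∀ u, |G u| ≤ L) (hM : 0 < M) (hMd : V d - V b < M ^ 2 / 2) (hc : 0 < c) {m : ℝ}
    (hm : b < m) (hmd : m < d) :
    ∃ u v : ℝ → ℝ, IsTruncatedMotion G c M u v ∧ u 0 = m ∧ (∀ y ≤ 0, m ≤ u y) ∧
      ∀ y, u y ∈ Icc a d ∧ |v y| ≤ M ∧ energy V M u v y ≤ V d := by
  obtain ⟨K, hK⟩ := exists_lipschitzWith_truncatedField hG c M
  choose u v h hu0 hum hE using fun n : ℕ => exists_motion_from_slope hw hG hL hM hc hm hmd n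
  have hvM : ∀ n, v n 0 ∈ Icc (-M) M := fun n =>
    abs_le.1 (hw.bounds_of_energy_lt hM hMd (hE n 0 (by simp))).2
  -- All positions at time 0 equal m, so only the velocities need a convergent subsequence.
  -- Continuous dependence then gives convergence at every time.
  obtain ⟨v₀, -, φ, hφ, hlim⟩ := isCompact_Icc.tendsto_subseq hvM
  obtain ⟨U, W, hU0, hW0, H⟩ := exists_isTruncatedMotion hG hL c hM m v₀
  have hpt : ∀ y, Tendsto (fun n => (u (φ n) y, v (φ n) y)) atTop (𝓝 (U y, W y)) := by
    intro y
    rw [tendsto_iff_dist_tendsto_zero]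
    have h0 : Tendsto (fun n => dist (v (φ n) 0) v₀ * Real.exp (K * |y|)) atTop (𝓝 0) := by
      simpa using (tendsto_iff_dist_tendsto_zero.1 hlim).mul_const (Real.exp (K * |y|))
    refine squeeze_zero (fun _ => dist_nonneg) (fun n => ?_) h0
    have := dist_integralCurve_le hK (h (φ n)).hasDerivAt_prodMk H.hasDerivAt_prodMk y
    rwa [hu0, hU0, hW0, Prod.dist_eq (x := (m, v (φ n) 0)), dist_self,
      max_eq_right dist_nonneg] at this
  have hptu : ∀ y, Tendsto (fun n => u (φ n) y) atTop (𝓝 (U y)) := fun y =>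
    (continuous_fst.tendsto _).comp (hpt y)
  have hptv : ∀ y, Tendsto (fun n => v (φ n) y) atTop (𝓝 (W y)) := fun y =>
    (continuous_snd.tendsto _).comp (hpt y)
  have hlarge : ∀ y : ℝ, ∀ᶠ n in atTop, -((φ n : ℕ) : ℝ) ≤ y := fun y => by
    filter_upwards [(tendsto_natCast_atTop_atTop.comp hφ.tendsto_atTop).eventually_ge_atTop (-y)]
      with n hn
    simp only [Function.comp_apply] at hn
    linarith
  refine ⟨U, W, H, hU0, fun y hy => ?_, fun y => ⟨?_, ?_, ?_⟩⟩
  · refine ge_of_tendsto (hptu y) ?_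
    filter_upwards [hlarge y] with n hn using hum (φ n) y ⟨hn, hy⟩
  · refine isClosed_Icc.mem_of_tendsto (hptu y) ?_
    filter_upwards [hlarge y] with n hn using
      (hw.bounds_of_energy_lt hM hMd (hE (φ n) y hn)).1
  · refine le_of_tendsto (hptv y).abs ?_
    filter_upwards [hlarge y] with n hn using
      (hw.bounds_of_energy_lt hM hMd (hE (φ n) y hn)).2
  · have h1 : Tendsto (fun n => energy V M (u (φ n)) (v (φ n)) y) atTop
        (𝓝 (energy V M U W y)) :=
      ((hasDerivAt_kinetic M (W y)).continuousAt.tendsto.comp (hptv y)).add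
        ((hw.hasDerivAt (U y)).continuousAt.tendsto.comp (hptu y))
    refine le_of_tendsto h1 ?_
    filter_upwards [hlarge y] with n hn using (hE (φ n) y hn).le

/-- In a potential well with damping there is a motion from the plateau to the bottom. -/
theorem PotentialWell.exists_connection (hw : PotentialWell G V a b d) (hG : LipschitzWith KG G)
    (hL : ∀ u, |G u| ≤ L) (hc : 0 < c) :
    ∃ u v : ℝ → ℝ, (∀ y, HasDerivAt u (v y) y) ∧
      (∀ y, HasDerivAt v (G (u y) - c * v y) y) ∧ (∀ y, u y ∈ Icc a d) ∧
      Tendsto u atBot (𝓝 d) ∧ Tendsto v atBot (𝓝 0) ∧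
      Tendsto u atTop (𝓝 b) ∧ Tendsto v atTop (𝓝 0) := by
  obtain ⟨M, hM, hMd⟩ : ∃ M : ℝ, 0 < M ∧ V d - V b < M ^ 2 / 2 := by
    have := hw.bottom_le d
    exact ⟨V d - V b + 2, by linarith, by nlinarith⟩
  have hlt := hw.lt_right
  obtain ⟨u, v, h, hu0, hum, hb⟩ := exists_motion_on_slope hw hG hL hM hMd hc
    (m := (b + d) / 2) (by linarith) (by linarith)
  have hvt : ∀ y, truncate M (v y) = v y := fun y => truncate_of_abs_le (hb y).2.1
  -- If no energy were lost, friction would force v = 0 throughout, and the particle would rest on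
  -- the slope, where the force is negative.
  obtain ⟨y₀, hy₀⟩ : ∃ y₀, energy V M u v y₀ < V d := by
    by_contra hcon
    push Not at hcon
    have hEc : energy V M u v = fun _ => V d :=
      funext fun y => le_antisymm (hb y).2.2 (hcon y)
    have hv0 : v = fun _ => 0 := by
      funext y
      have h1 := h.hasDerivAt_energy hw.hasDerivAt y
      rw [hEc] at h1
      have h2 := h1.unique (hasDerivAt_const y (V d))
      rw [hvt] at h2
      have h3 : v y ^ 2 = 0 := by
        rcases mul_eq_zero.1 (neg_eq_zero.1 h2) with h4 | h4
        · exact absurd h4 hc.ne'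
        · exact h4
      exact pow_eq_zero_iff two_ne_zero |>.1 h3
    have h4 := (h 0).2
    rw [hvt, hv0, hu0] at h4
    have h5 := h4.unique (hasDerivAt_const 0 (0 : ℝ))
    have h6 := hw.neg ((b + d) / 2) (by linarith) (by linarith)
    simp only [mul_zero, sub_zero] at h5
    linarith
  obtain ⟨h1, h2⟩ := h.tendsto_bottom hw hG hL hM hc hy₀
  obtain ⟨h3, h4⟩ := h.tendsto_plateau hw hG hL hM hc (m := (b + d) / 2) (by linarith)
    (fun y hy => ⟨hum y hy, (hb y).1.2⟩) fun y => (hb y).2.2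
  refine ⟨u, v, fun y => ?_, fun y => ?_, fun y => (hb y).1, h3, h4, h1, h2⟩
  · simpa only [hvt] using (h y).1
  · simpa only [hvt] using (h y).2

end

/-! ### Oscillation at the rest point -/

/-- Sturm comparison on a half line: if `z'' + c z' ≤ -κ z` with `κ > c² / 4` and `z ≥ 0` on a half
line, then `z = 0` there. -/
theorem eq_zero_of_oscillatory {z w N : ℝ → ℝ} {c κ Y : ℝ} (hκ : c ^ 2 / 4 < κ)
    (hz : ∀ y, HasDerivAt z (w y) y) (hw : ∀ y, HasDerivAt w (N y - c * w y) y)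
    (hz0 : ∀ y, Y ≤ y → 0 ≤ z y) (hN : ∀ y, Y ≤ y → N y ≤ -κ * z y) {y : ℝ} (hy : Y ≤ y) :
    z y = 0 := by
  obtain ⟨ω, hω, hω2⟩ : ∃ ω : ℝ, 0 < ω ∧ ω ^ 2 = κ - c ^ 2 / 4 :=
    ⟨√(κ - c ^ 2 / 4), Real.sqrt_pos.2 (by linarith), Real.sq_sqrt (by linarith)⟩
  have hlin : ∀ t, HasDerivAt (fun t => ω * (t - y)) ω t := fun t => by
    simpa using ((hasDerivAt_id t).sub_const y).const_mul ω
  have hexp : ∀ t, HasDerivAt (fun t => Real.exp (c / 2 * t)) (Real.exp (c / 2 * t) * (c / 2)) t :=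
    fun t => by simpa using ((hasDerivAt_id t).const_mul (c / 2)).exp
  -- The negative Wronskian of exp(ct / 2) z and sin(ω(t - y)). It is nondecreasing on the half
  -- period [y, y + π / ω], is a nonnegative multiple of z at the left end, and a nonpositive one at
  -- the right end.
  have hW : ∀ t, HasDerivAt (fun t => -(Real.exp (c / 2 * t) * ((w t + c / 2 * z t) *
      Real.sin (ω * (t - y)) - ω * z t * Real.cos (ω * (t - y)))))
      (Real.exp (c / 2 * t) * Real.sin (ω * (t - y)) * (-κ * z t - N t)) t := fun t => by
    refine ((hexp t).fun_mul ((((hw t).fun_add ((hz t).const_mul (c / 2))).fun_mul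
      (hlin t).sin).fun_sub (((hz t).const_mul ω).fun_mul (hlin t).cos))).fun_neg.congr_deriv ?_
    rw [show κ = ω ^ 2 + c ^ 2 / 4 by linarith]
    ring
  have hend : y ≤ y + Real.pi / ω := by
    have := div_pos Real.pi_pos hω
    linarith
  have hle := le_of_hasDerivAt_nonneg hW hend fun t ht => by
    have h1 : 0 ≤ Real.sin (ω * (t - y)) := by
      apply Real.sin_nonneg_of_nonneg_of_le_pi
      · exact mul_nonneg hω.le (by linarith [ht.1])
      · have h2 : t - y ≤ Real.pi / ω := by linarith [ht.2]
        rwa [le_div_iff₀ hω, mul_comm] at h2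
    have h2 := hN t (hy.trans ht.1.le)
    exact mul_nonneg (mul_nonneg (Real.exp_pos _).le h1) (by linarith)
  have hpi : ω * (y + Real.pi / ω - y) = Real.pi := by
    field_simp
    ring
  simp only [hpi, sub_self, mul_zero, Real.sin_zero, Real.cos_zero, Real.sin_pi, Real.cos_pi] at hle
  have h1 := hz0 y hy
  have h2 := hz0 _ (hy.trans hend)
  have h3 : 0 ≤ Real.exp (c / 2 * (y + Real.pi / ω)) * (ω * z (y + Real.pi / ω)) := by positivity
  have h4 : Real.exp (c / 2 * y) * (ω * z y) ≤ 0 := by linarith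
  refine le_antisymm ?_ h1
  by_contra hpos
  push Not at hpos
  have : 0 < Real.exp (c / 2 * y) * (ω * z y) := by positivity
  linarith

section

variable {g u v : ℝ → ℝ} {c κ p q : ℝ}

/-- Near an oscillatory rest point, a solution that eventually stays on one side of the rest point
is eventually at rest. -/
theorem eventually_eq_of_eventually_one_sided {σ : ℝ} (hσ : |σ| = 1)
    (hu : ∀ y, HasDerivAt u (v y) y) (hv : ∀ y, HasDerivAt v (g (u y) - c * v y) y)
    (hgp : g p = 0) (hg : HasDerivAt g (-κ) p) (hκ : c ^ 2 / 4 < κ) (hlim : Tendsto u atTop (𝓝 p))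
    (hside : ∀ᶠ y in atTop, 0 ≤ σ * (u y - p)) : ∀ᶠ y in atTop, u y = p := by
  -- A rate strictly between c² / 4 and κ: the gap κ - κ' absorbs the error of the linearisation
  -- near p.
  set κ' := (κ + c ^ 2 / 4) / 2 with hκ'
  have hlo := hlim.eventually (hg.isLittleO.def (show 0 < κ - κ' by linarith))
  obtain ⟨Y, hY⟩ := eventually_atTop.1 (hlo.and hside)
  filter_upwards [eventually_ge_atTop Y] with y hy
  have h0 : σ * (u y - p) = 0 := by
    refine eq_zero_of_oscillatory (z := fun y => σ * (u y - p)) (w := fun y => σ * v y)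
      (N := fun y => σ * g (u y)) (c := c) (κ := κ') (Y := Y) (by linarith)
      (fun t => ((hu t).sub_const p).const_mul σ)
      (fun t => ((hv t).const_mul σ).congr_deriv (by ring)) (fun t ht => (hY t ht).2)
      (fun t ht => ?_) hy
    obtain ⟨h1, h2⟩ := hY t ht
    rw [hgp, sub_zero, Real.norm_eq_abs, Real.norm_eq_abs, smul_eq_mul] at h1
    have h3 : |u t - p| = σ * (u t - p) := by
      rw [← abs_of_nonneg h2, abs_mul, hσ, one_mul]
    have h4 : σ * (g (u t) - (u t - p) * -κ) ≤ |g (u t) - (u t - p) * -κ| := by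
      have := le_abs_self (σ * (g (u t) - (u t - p) * -κ))
      rwa [abs_mul, hσ, one_mul] at this
    rw [h3] at h1
    linarith
  have hσ0 : σ ≠ 0 := by
    rintro rfl
    simp at hσ
  rcases mul_eq_zero.1 h0 with h | h
  · exact absurd h hσ0
  · linarith

/-- A solution that is at a rest point at one time has been there at all earlier times. -/
theorem eq_of_eq_rest_point (hu : ∀ y, HasDerivAt u (v y) y)
    (hv : ∀ y, HasDerivAt v (g (u y) - c * v y) y) (hg : LocallyLipschitz g) (hgp : g p = 0)
    {Y : ℝ} (huY : u Y = p) (hvY : v Y = 0) {y : ℝ} (hy : y ≤ Y) : u y = p := by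
  have huc : Continuous u := continuous_iff_continuousAt.2 fun t => (hu t).continuousAt
  set S := u '' Icc y Y with hS
  have hSc : IsCompact S := isCompact_Icc.image huc
  obtain ⟨K, hK⟩ := (hg.locallyLipschitzOn (s := S)).exists_lipschitzOnWith_of_compact hSc
  have h1 : LipschitzOnWith (1 : NNReal) (fun x : ℝ × ℝ => x.2) (S ×ˢ univ) :=
    LipschitzWith.prod_snd.lipschitzOnWith
  have h2 : LipschitzOnWith (K * 1) (fun x : ℝ × ℝ => g x.1) (S ×ˢ univ) :=
    hK.comp LipschitzWith.prod_fst.lipschitzOnWith fun x hx => hx.1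
  have h3 : LipschitzOnWith (‖c‖₊ * 1) (fun x : ℝ × ℝ => c * x.2) (S ×ˢ univ) :=
    (lipschitzWith_smul c).lipschitzOnWith (s := univ).comp h1 fun _ _ => trivial
  have hF := h1.prodMk (h2.sub h3)
  have hpS : p ∈ S := ⟨Y, right_mem_Icc.2 hy, huY⟩
  have hd : ∀ t, HasDerivAt (fun t => (u t, v t)) (v t, g (u t) - c * v t) t := fun t =>
    (hu t).prodMk (hv t)
  have hconst : ∀ t : ℝ, HasDerivAt (fun _ : ℝ => (p, (0 : ℝ))) ((0 : ℝ), g p - c * 0) t :=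
    fun t => by
      rw [hgp, mul_zero, sub_zero]
      exact hasDerivAt_const _ _
  have heq := ODE_solution_unique_of_mem_Icc_left (a := y) (b := Y)
    (v := fun _ (x : ℝ × ℝ) => (x.2, g x.1 - c * x.2)) (s := fun _ => S ×ˢ univ)
    (f := fun t => (u t, v t)) (g := fun _ => (p, 0)) (fun _ _ => hF)
    (fun t _ => (hd t).continuousAt.continuousWithinAt) (fun t _ => (hd t).hasDerivWithinAt)
    (fun t ht => ⟨⟨t, Ioc_subset_Icc_self ht, rfl⟩, trivial⟩)
    (fun t _ => (hconst t).continuousAt.continuousWithinAt)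
    (fun t _ => (hconst t).hasDerivWithinAt) (fun t _ => ⟨hpS, trivial⟩)
    (by simp [huY, hvY]) (left_mem_Icc.2 hy)
  exact congrArg Prod.fst heq

/-- A solution that tends to an oscillatory rest point, and comes from elsewhere, is on each side of
the rest point arbitrarily late. -/
theorem frequently_one_sided {σ : ℝ} (hσ : |σ| = 1)
    (hu : ∀ y, HasDerivAt u (v y) y) (hv : ∀ y, HasDerivAt v (g (u y) - c * v y) y)
    (hgl : LocallyLipschitz g) (hgp : g p = 0) (hg : HasDerivAt g (-κ) p) (hκ : c ^ 2 / 4 < κ)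
    (hlim : Tendsto u atTop (𝓝 p)) (hbot : Tendsto u atBot (𝓝 q)) (hpq : p ≠ q) :
    ∃ᶠ y in atTop, σ * (u y - p) < 0 := by
  by_contra hcon
  simp only [not_frequently, not_lt] at hcon
  obtain ⟨Y, hY⟩ := eventually_atTop.1
    (eventually_eq_of_eventually_one_sided hσ hu hv hgp hg hκ hlim hcon)
  -- At Y + 1, unlike at Y, u is known to be constant on a full neighbourhood.
  have hvY : v (Y + 1) = 0 := by
    have hev : u =ᶠ[𝓝 (Y + 1)] fun _ => p := by
      filter_upwards [Ioi_mem_nhds (show Y < Y + 1 by linarith)] with y hy using hY y (le_of_lt hy)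
    exact (hu (Y + 1)).unique ((hasDerivAt_const _ p).congr_of_eventuallyEq hev)
  refine hpq (tendsto_nhds_unique (tendsto_const_nhds.congr' ?_) hbot)
  filter_upwards [eventually_le_atBot (Y + 1)] with y hy
  exact (eq_of_eq_rest_point hu hv hgl hgp (hY _ (by linarith)) hvY hy).symm

end

/-! ### The profile nonlinearity in logarithmic coordinates -/

/-- The profile nonlinearity in terms of the two constants. -/
noncomputable def profile (γ C A p : ℝ) : ℝ := p ^ γ - C + A ^ 2 / p

theorem profileF_eq_profile (γ s P J : ℝ) :
    profileF γ s P J = profile γ (constA s P J * s + constB γ s P J) (constA s P J) := rfl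

theorem profileF_self {γ s P J : ℝ} (hP : P ≠ 0) : profileF γ s P J P = 0 := by
  unfold profileF constA constB
  field_simp
  ring

theorem profileF_eq_of_rankineHugoniot {γ s Pm Jm Pp Jp : ℝ}
    (h : RankineHugoniot γ s Pm Jm Pp Jp) : profileF γ s Pp Jp = profileF γ s Pm Jm := by
  rw [profileF_eq_profile, profileF_eq_profile, h.constA_eq, h.constB_eq]

theorem mul_profile {γ C A p : ℝ} (hp : 0 < p) :
    p * profile γ C A p = p ^ (γ + 1) + (-C * p + A ^ 2) := by
  unfold profile
  rw [Real.rpow_add_one hp.ne']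
  field_simp
  ring

/-- Multiplication by p > 0 keeps the sign of f and turns A² / p into a constant, leaving a strictly
convex power plus an affine function. Chords through its zeros give the signs of f. -/
theorem strictConvexOn_mul_profile {γ : ℝ} (hγ : 1 ≤ γ) (C A : ℝ) :
    StrictConvexOn ℝ (Ici 0) fun p : ℝ => p ^ (γ + 1) + (-C * p + A ^ 2) :=
  (strictConvexOn_rpow (show 1 < γ + 1 by linarith)).add_convexOn
    (((-C • LinearMap.id : ℝ →ₗ[ℝ] ℝ).convexOn (convex_Ici 0)).add_const (A ^ 2))

section

variable {γ C A lo hi : ℝ}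

theorem profile_neg_of_mem_Ioo (hγ : 1 ≤ γ) (hlo : 0 < lo) (hflo : profile γ C A lo = 0)
    (hfhi : profile γ C A hi = 0) {p : ℝ} (h1 : lo < p) (h2 : p < hi) : profile γ C A p < 0 := by
  have hp := hlo.trans h1
  have hhi := hp.trans h2
  have h := (strictConvexOn_mul_profile hγ C A).lt_on_openSegment (mem_Ici.2 hlo.le)
    (mem_Ici.2 hhi.le) (h1.trans h2).ne
    (show p ∈ openSegment ℝ lo hi by rw [openSegment_eq_Ioo (h1.trans h2)]; exact ⟨h1, h2⟩)
  rw [← mul_profile hp, ← mul_profile hlo, ← mul_profile hhi, hflo, hfhi, mul_zero, mul_zero,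
    max_self] at h
  exact neg_of_mul_neg_right h hp.le

theorem profile_pos_of_lt (hγ : 1 ≤ γ) (hlt : lo < hi) (hflo : profile γ C A lo = 0)
    (hfhi : profile γ C A hi = 0) {p : ℝ} (hp : 0 < p) (h1 : p < lo) : 0 < profile γ C A p := by
  have hlo := hp.trans h1
  have hhi := hlo.trans hlt
  have h := (strictConvexOn_mul_profile hγ C A).lt_on_openSegment (mem_Ici.2 hp.le)
    (mem_Ici.2 hhi.le) (h1.trans hlt).ne
    (show lo ∈ openSegment ℝ p hi by rw [openSegment_eq_Ioo (h1.trans hlt)]; exact ⟨h1, hlt⟩)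
  rw [← mul_profile hp, ← mul_profile hlo, ← mul_profile hhi, hflo, hfhi, mul_zero, mul_zero,
    lt_max_iff] at h
  rcases h with h | h
  · exact pos_of_mul_pos_right h hp.le
  · exact absurd h (lt_irrefl _)

/-- With A = 0 the profile nonlinearity would be strictly increasing and could not have two positive
zeros. It is A² that produces the left wall. -/
theorem constant_ne_zero (hγ : 1 ≤ γ) (hlo : 0 < lo) (hlt : lo < hi)
    (hflo : profile γ C A lo = 0) (hfhi : profile γ C A hi = 0) : A ≠ 0 := by
  rintro rfl
  have h := Real.rpow_lt_rpow hlo.le hlt (show 0 < γ by linarith)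
  simp only [profile] at hflo hfhi
  simp only [ne_eq, OfNat.ofNat_ne_zero, not_false_eq_true, zero_pow, zero_div] at hflo hfhi
  linarith

/-- The force in logarithmic coordinates. -/
noncomputable def force (γ C A k u : ℝ) : ℝ :=
  2 / k ^ 2 * (Real.exp ((γ - 1) * u) - C * Real.exp (-u) + A ^ 2 * Real.exp (-2 * u))

theorem force_eq (γ C A k u : ℝ) :
    force γ C A k u = 2 / k ^ 2 * (profile γ C A (Real.exp u) * Real.exp (-u)) := by
  unfold force profile
  congr 1
  rw [← Real.exp_mul, sub_mul, Real.exp_sub, show -2 * u = -u + -u by ring, Real.exp_add,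
    Real.exp_neg, mul_comm u γ, one_mul]
  have := (Real.exp_pos u).ne'
  field_simp

theorem contDiff_force (γ C A k : ℝ) : ContDiff ℝ 1 (force γ C A k) := by
  unfold force
  fun_prop

theorem force_log_eq_zero {k p : ℝ} (hp : 0 < p) (hf : profile γ C A p = 0) :
    force γ C A k (Real.log p) = 0 := by
  rw [force_eq, Real.exp_log hp, hf, zero_mul, mul_zero]

/-- At a zero of f the derivative of the factor e⁻ᵘ does not contribute, and e⁻ᵘ cancels the eᵘ of
the chain rule. -/
theorem hasDerivAt_force {k p : ℝ} (hp : 0 < p) (hf : profile γ C A p = 0) :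
    HasDerivAt (force γ C A k) (2 / k ^ 2 * deriv (profile γ C A) p) (Real.log p) := by
  have hd : DifferentiableAt ℝ (profile γ C A) p := by
    unfold profile
    exact ((differentiableAt_id.rpow_const (Or.inl hp.ne')).sub_const C).add
      ((differentiableAt_const _).div differentiableAt_id hp.ne')
  have hd' : HasDerivAt (profile γ C A) (deriv (profile γ C A) p) (Real.exp (Real.log p)) := by
    rw [Real.exp_log hp]
    exact hd.hasDerivAt
  have h := (((hd'.comp (Real.log p) (Real.hasDerivAt_exp _)).fun_mul
    (hasDerivAt_neg (Real.log p)).exp)).const_mul (2 / k ^ 2)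
  refine (h.congr_of_eventuallyEq (Eventually.of_forall fun u => force_eq γ C A k u)).congr_deriv ?_
  rw [Function.comp_apply, Real.exp_log hp, hf, Real.exp_neg, Real.exp_log hp]
  have := hp.ne'
  field_simp
  ring

/-- As a → -∞ the quadratic term in e⁻ᵃ dominates, so the left side tends to -∞. The expression is
minus the part of the potential that comes from C and A. -/
theorem exists_wall {k b d : ℝ} (hk : 0 < k) (hA : A ≠ 0) :
    ∃ a < b, 2 / k ^ 2 * (C * Real.exp (-a) - A ^ 2 / 2 * Real.exp (-2 * a)) ≤
      2 / k ^ 2 * (C * Real.exp (-d) - A ^ 2 / 2 * Real.exp (-2 * d)) := by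
  set D := C * Real.exp (-d) - A ^ 2 / 2 * Real.exp (-2 * d) with hD
  have hA2 : 0 < A ^ 2 := by positivity
  -- Here x plays e⁻ᵃ. Its summands ensure x ≥ 1, a < b and A² x / 2 - C ≥ |D|.
  set x := 1 + Real.exp (-b) + 2 * (|C| + |D|) / A ^ 2 with hx
  have hr : 0 ≤ 2 * (|C| + |D|) / A ^ 2 := by positivity
  have hb := Real.exp_pos (-b)
  have hx1 : 1 ≤ x := by linarith
  have hx0 : 0 < x := by linarith
  refine ⟨-Real.log x, ?_, ?_⟩
  · have : Real.log (Real.exp (-b)) < Real.log x := Real.log_lt_log hb (by linarith)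
    rw [Real.log_exp] at this
    linarith
  · refine mul_le_mul_of_nonneg_left ?_ (by positivity)
    rw [show -2 * -Real.log x = Real.log x + Real.log x by ring, Real.exp_add, neg_neg,
      Real.exp_log hx0]
    have h1 : 2 * (|C| + |D|) / A ^ 2 ≤ x := by linarith
    rw [div_le_iff₀ hA2] at h1
    have h2 : |D| ≤ A ^ 2 / 2 * x - C := by linarith [le_abs_self C]
    have h3 : |D| ≤ x * (A ^ 2 / 2 * x - C) :=
      h2.trans (le_mul_of_one_le_left ((abs_nonneg D).trans h2) hx1)
    linarith [neg_abs_le D]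

/-- The force, frozen outside a suitable interval, is that of a potential well. -/
theorem exists_potentialWell_force {k : ℝ} (hγ : 1 ≤ γ) (hk : 0 < k) (hlo : 0 < lo)
    (hlt : lo < hi) (hflo : profile γ C A lo = 0) (hfhi : profile γ C A hi = 0) :
    ∃ (G V : ℝ → ℝ) (a L : ℝ) (K : NNReal), PotentialWell G V a (Real.log lo) (Real.log hi) ∧
      LipschitzWith K G ∧ (∀ u, |G u| ≤ L) ∧
      ∀ u ∈ Icc a (Real.log hi), G u = force γ C A k u := by
  have hk2 : 0 < 2 / k ^ 2 := by positivity
  have hbd : Real.log lo < Real.log hi := Real.log_lt_log hlo hlt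
  obtain ⟨a, hab, hwall⟩ := exists_wall (C := C) (b := Real.log lo) (d := Real.log hi) hk
    (constant_ne_zero hγ hlo hlt hflo hfhi)
  set d := Real.log hi with hd
  set b := Real.log lo with hb
  have had : a ≤ d := (hab.trans hbd).le
  set cl : ℝ → ℝ := fun u => max a (min d u) with hcl
  have hclLip : LipschitzWith 1 cl := (LipschitzWith.id.const_min d).const_max a
  have hclmem : ∀ u, cl u ∈ Icc a d := fun u => ⟨le_max_left _ _, max_le had (min_le_left _ _)⟩
  have hclid : ∀ u ∈ Icc a d, cl u = u := fun u hu => by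
    simp only [hcl]
    rw [min_eq_right hu.2, max_eq_right hu.1]
  obtain ⟨K, hK⟩ := ((contDiff_force γ C A k).locallyLipschitz.locallyLipschitzOn
    (s := Icc a d)).exists_lipschitzOnWith_of_compact isCompact_Icc
  have hGLip : LipschitzWith (K * 1) fun u => force γ C A k (cl u) := by
    rw [← lipschitzOnWith_univ]
    exact hK.comp hclLip.lipschitzOnWith fun u _ => hclmem u
  obtain ⟨L, hL⟩ := isCompact_Icc.exists_bound_of_continuousOn (s := Icc a d)
    (contDiff_force γ C A k).continuous.continuousOn
  set G : ℝ → ℝ := fun u => force γ C A k (cl u) with hG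
  have hV : ∀ u, HasDerivAt (fun u => ∫ t in (0 : ℝ)..u, -G t) (-G u) u := fun u =>
    intervalIntegral.integral_hasDerivAt_right
      (hGLip.continuous.neg.intervalIntegrable _ _)
      (hGLip.continuous.neg.stronglyMeasurableAtFilter _ _)
      hGLip.continuous.neg.continuousAt
  refine ⟨G, fun u => ∫ t in (0 : ℝ)..u, -G t, a, L, K * 1,
    ⟨hV, hab, hbd, ?_, ?_, ?_, ?_, ?_⟩, hGLip, fun u => hL _ (hclmem u), fun u hu => ?_⟩
  · intro u hu
    have h1 : cl u < b := max_lt hab (min_lt_of_right_lt hu)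
    simp only [hG]
    rw [force_eq]
    refine mul_pos hk2 (mul_pos (profile_pos_of_lt hγ hlt hflo hfhi (Real.exp_pos _) ?_)
      (Real.exp_pos _))
    rwa [← Real.lt_log_iff_exp_lt hlo]
  · simp only [hG]
    rw [hclid b ⟨hab.le, hbd.le⟩]
    exact force_log_eq_zero hlo hflo
  · intro u h1 h2
    simp only [hG]
    rw [hclid u ⟨(hab.trans h1).le, h2.le⟩, force_eq]
    refine mul_neg_of_pos_of_neg hk2 (mul_neg_of_neg_of_pos
      (profile_neg_of_mem_Ioo hγ hlo hflo hfhi ?_ ?_) (Real.exp_pos _))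
    · rwa [← Real.log_lt_iff_lt_exp hlo]
    · rwa [← Real.lt_log_iff_exp_lt (hlo.trans hlt)]
  · intro u hu
    simp only [hG, hcl]
    rw [min_eq_left hu, max_eq_right had]
    exact force_log_eq_zero (hlo.trans hlt) hfhi
  -- Adding Ψ to the potential leaves only the pressure force, which is positive, so V + Ψ decreases
  -- on [a, d]. This avoids integrating exp((γ - 1)u), whose primitive has another form when γ = 1.
  · set Ψ : ℝ → ℝ := fun u => 2 / k ^ 2 * (C * Real.exp (-u) - A ^ 2 / 2 * Real.exp (-2 * u))
      with hΨ
    have hΨd : ∀ u, HasDerivAt Ψ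
        (2 / k ^ 2 * (-C * Real.exp (-u) + A ^ 2 * Real.exp (-2 * u))) u := fun u => by
      refine ((((hasDerivAt_neg u).exp.const_mul C).fun_sub
        (((hasDerivAt_id u).const_mul (-2)).exp.const_mul (A ^ 2 / 2))).const_mul
        (2 / k ^ 2)).congr_deriv ?_
      simp only [id]
      ring
    have h := le_of_hasDerivAt_nonneg (fun u => ((hV u).fun_add (hΨd u)).fun_neg) had
      fun u hu => by
        simp only [hG]
        rw [hclid u (Ioo_subset_Icc_self hu)]
        have := mul_pos hk2 (Real.exp_pos ((γ - 1) * u))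
        unfold force
        linarith
    have hw : Ψ a ≤ Ψ d := hwall
    linarith
  · simp only [hG]
    rw [hclid u hu]

theorem exists_isHeteroclinic {k s μ : ℝ} (hγ : 1 ≤ γ) (hk : 0 < k) (hμ : 0 < μ) (hs : 0 < s)
    (hlo : 0 < lo) (hlt : lo < hi) (hflo : profile γ C A lo = 0) (hfhi : profile γ C A hi = 0) :
    ∃ P Q : ℝ → ℝ, IsHeteroclinic (profile γ C A) s μ k hi lo P Q := by
  obtain ⟨G, V, a, L, K, hw, hK, hL, hG⟩ :=
    exists_potentialWell_force hγ hk hlo hlt hflo hfhi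
  obtain ⟨u, v, hu, hv, hmem, hub, hvb, hut, hvt⟩ :=
    hw.exists_connection hK hL (show 0 < 2 * s * μ / k ^ 2 by positivity)
  have hexp : ∀ {l : Filter ℝ} {p : ℝ}, 0 < p → Tendsto u l (𝓝 (Real.log p)) →
      Tendsto v l (𝓝 0) →
      Tendsto (fun y => (Real.exp (u y), Real.exp (u y) * v y)) l (𝓝 (p, 0)) := by
    intro l p hp hul hvl
    have h1 := (Real.continuous_exp.tendsto _).comp hul
    rw [Real.exp_log hp] at h1
    have h2 := h1.mul hvl
    rw [mul_zero] at h2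
    exact h1.prodMk_nhds h2
  refine ⟨fun y => Real.exp (u y), fun y => Real.exp (u y) * v y,
    { pos := fun y => Real.exp_pos _
      deriv_P := fun y => (hu y).exp
      deriv_Q := fun y => ?_
      tendsto_atBot := hexp (hlo.trans hlt) hub hvb
      tendsto_atTop := hexp hlo hut hvt }⟩
  refine ((hu y).exp.fun_mul (hv y)).congr_deriv ?_
  rw [hG _ (hmem y), force_eq, Real.exp_neg]
  have := (Real.exp_pos (u y)).ne'
  field_simp
  ring

theorem IsTrajectory.log_system {k s μ : ℝ} {P Q : ℝ → ℝ}
    (h : IsTrajectory (profile γ C A) s μ k P Q) :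
    (∀ y, HasDerivAt (fun y => Real.log (P y)) (Q y / P y) y) ∧
    ∀ y, HasDerivAt (fun y => Q y / P y)
      (force γ C A k (Real.log (P y)) - 2 * s * μ / k ^ 2 * (Q y / P y)) y := by
  refine ⟨fun y => (h.deriv_P y).log (h.pos y).ne', fun y => ?_⟩
  refine ((h.deriv_Q y).fun_div (h.deriv_P y) (h.pos y).ne').congr_deriv ?_
  rw [force_eq, Real.exp_neg, Real.exp_log (h.pos y)]
  have := (h.pos y).ne'
  field_simp
  ring

/-- The condition on sμ / k, squared and divided by k², is c² / 4 < κ for the friction c = 2sμ / k²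
and the linearised stiffness κ = -(2 / k²) f'(Pp). -/
theorem IsHeteroclinic.oscillatesAbout {k s μ Pm Pp : ℝ} (hk : 0 < k) (hμ : 0 < μ) (hs : 0 < s)
    (hPp : 0 < Pp) (hPm : 0 < Pm) (hne : Pp ≠ Pm) (hf : profile γ C A Pp = 0)
    (hosc : s * μ / k < √(-2 * deriv (profile γ C A) Pp)) {P Q : ℝ → ℝ}
    (h : IsHeteroclinic (profile γ C A) s μ k Pm Pp P Q) : OscillatesAbout P Pp atTop := by
  obtain ⟨hu, hv⟩ := h.toIsTrajectory.log_system
  have hlogP : ∀ {l : Filter ℝ} {p : ℝ}, 0 < p → Tendsto (fun y => (P y, Q y)) l (𝓝 (p, 0)) →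
      Tendsto (fun y => Real.log (P y)) l (𝓝 (Real.log p)) := fun hp hl =>
    (Real.continuousAt_log hp.ne').tendsto.comp ((continuous_fst.tendsto _).comp hl)
  have hκ : (2 * s * μ / k ^ 2) ^ 2 / 4 < -(2 / k ^ 2 * deriv (profile γ C A) Pp) := by
    have h1 := (Real.lt_sqrt (by positivity)).1 hosc
    have h2 : (2 * s * μ / k ^ 2) ^ 2 / 4 = (s * μ / k) ^ 2 / k ^ 2 := by
      field_simp
      norm_num
    rw [h2, show -(2 / k ^ 2 * deriv (profile γ C A) Pp) =
      (-2 * deriv (profile γ C A) Pp) / k ^ 2 by ring]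
    exact div_lt_div_of_pos_right h1 (by positivity)
  have hd := hasDerivAt_force (k := k) hPp hf
  rw [← neg_neg (2 / k ^ 2 * deriv (profile γ C A) Pp)] at hd
  have hfreq : ∀ σ : ℝ, |σ| = 1 → ∃ᶠ y in atTop, σ * (Real.log (P y) - Real.log Pp) < 0 :=
    fun σ hσ => frequently_one_sided hσ hu hv (contDiff_force γ C A k).locallyLipschitz
      (force_log_eq_zero hPp hf) hd hκ (hlogP hPp h.tendsto_atTop) (hlogP hPm h.tendsto_atBot)
      fun heq => hne (Real.log_injOn_pos hPp hPm heq)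
  constructor
  · refine (hfreq 1 (by simp)).mono fun y hy => ?_
    rw [← Real.log_lt_log_iff (h.pos y) hPp]
    linarith
  · refine (hfreq (-1) (by simp)).mono fun y hy => ?_
    rw [← Real.log_lt_log_iff hPp (h.pos y)]
    linarith

end

/-! ### Non-monotonicity, time reversal and the theorem -/

theorem OscillatesAbout.nonMonotone {P : ℝ → ℝ} {c : ℝ} (h : OscillatesAbout P c atTop)
    (hlim : Tendsto P atTop (𝓝 c)) : NonMonotone P := by
  constructor
  · intro hm
    obtain ⟨y, hy⟩ := h.2.exists
    exact absurd (hm.ge_of_tendsto hlim y) (not_le.2 hy)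
  · intro hm
    obtain ⟨y, hy⟩ := h.1.exists
    exact absurd (hm.le_of_tendsto hlim y) (not_le.2 hy)

/-- Reversing time flips the sign of Q, so only the friction term changes sign. The function f stays
fixed, although its constants were computed with s. -/
theorem IsHeteroclinic.reverse {f : ℝ → ℝ} {s μ k Pm Pp : ℝ} {P Q : ℝ → ℝ}
    (h : IsHeteroclinic f s μ k Pm Pp P Q) :
    IsHeteroclinic f (-s) μ k Pp Pm (fun y => P (-y)) fun y => -Q (-y) where
  pos y := h.pos (-y)
  deriv_P y := hasDerivAt_comp_neg_of (h.deriv_P (-y))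
  deriv_Q y := (hasDerivAt_comp_neg_of (h.deriv_Q (-y))).fun_neg.congr_deriv (by ring)
  tendsto_atBot := by
    have := h.tendsto_atTop.comp tendsto_neg_atBot_atTop
    simpa using ((continuous_fst.tendsto _).comp this).prodMk_nhds
      ((continuous_snd.tendsto _).comp this).neg
  tendsto_atTop := by
    have := h.tendsto_atBot.comp tendsto_neg_atTop_atBot
    simpa using ((continuous_fst.tendsto _).comp this).prodMk_nhds
      ((continuous_snd.tendsto _).comp this).neg

theorem NonMonotone.of_comp_neg {P : ℝ → ℝ} (h : NonMonotone fun y => P (-y)) : NonMonotone P :=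
  ⟨fun hm => h.2 fun _ _ hxy => hm (neg_le_neg hxy),
    fun hm => h.1 fun _ _ hxy => hm (neg_le_neg hxy)⟩

theorem OscillatesAbout.of_comp_neg {P : ℝ → ℝ} {c : ℝ}
    (h : OscillatesAbout (fun y => P (-y)) c atTop) : OscillatesAbout P c atBot :=
  ⟨tendsto_neg_atTop_atBot.frequently h.1, tendsto_neg_atTop_atBot.frequently h.2⟩

end QHD

theorem mainTheorem1 (γ μ k s Pm Jm Pp Jp : ℝ) (hγ : 1 ≤ γ) (hμ : 0 < μ) (hk : 0 < k)
    (hRH : QHD.RankineHugoniot γ s Pm Jm Pp Jp) :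
    (0 < s → 0 < Pp → Pp < Pm →
      (∃ P Q : ℝ → ℝ, QHD.IsHeteroclinic (QHD.profileF γ s Pm Jm) s μ k Pm Pp P Q) ∧
      (s * μ / k < Real.sqrt (-2 * deriv (QHD.profileF γ s Pm Jm) Pp) →
        ∀ P Q : ℝ → ℝ, QHD.IsHeteroclinic (QHD.profileF γ s Pm Jm) s μ k Pm Pp P Q →
          QHD.NonMonotone P ∧ QHD.OscillatesAbout P Pp Filter.atTop)) ∧
    (s < 0 → 0 < Pm → Pm < Pp →
      (∃ P Q : ℝ → ℝ, QHD.IsHeteroclinic (QHD.profileF γ s Pm Jm) s μ k Pm Pp P Q) ∧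
      (-(s * μ / k) < Real.sqrt (-2 * deriv (QHD.profileF γ s Pm Jm) Pm) →
        ∀ P Q : ℝ → ℝ, QHD.IsHeteroclinic (QHD.profileF γ s Pm Jm) s μ k Pm Pp P Q →
          QHD.NonMonotone P ∧ QHD.OscillatesAbout P Pm Filter.atBot)) := by
  have hfm : Pm ≠ 0 → QHD.profileF γ s Pm Jm Pm = 0 := QHD.profileF_self
  have hfp : Pp ≠ 0 → QHD.profileF γ s Pm Jm Pp = 0 := fun h => by
    rw [← QHD.profileF_eq_of_rankineHugoniot hRH]
    exact QHD.profileF_self h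
  rw [QHD.profileF_eq_profile] at *
  refine ⟨fun hs hPp hlt => ?_, fun hs hPm hlt => ?_⟩
  · have hPm := hPp.trans hlt
    refine ⟨QHD.exists_isHeteroclinic hγ hk hμ hs hPp hlt (hfp hPp.ne') (hfm hPm.ne'),
      fun hosc P Q h => ?_⟩
    have ho := h.oscillatesAbout hk hμ hs hPp hPm hlt.ne (hfp hPp.ne') hosc
    exact ⟨ho.nonMonotone ((continuous_fst.tendsto _).comp h.tendsto_atTop), ho⟩
  · have hPp := hPm.trans hlt
    have hs' : 0 < -s := by linarith
    constructor
    · obtain ⟨P, Q, h⟩ := QHD.exists_isHeteroclinic hγ hk hμ hs' hPm hlt (hfm hPm.ne')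
        (hfp hPp.ne')
      have hr := h.reverse
      rw [neg_neg] at hr
      exact ⟨_, _, hr⟩
    · intro hosc P Q h
      have hosc' : -s * μ / k < Real.sqrt (-2 * deriv (QHD.profile γ
          (QHD.constA s Pm Jm * s + QHD.constB γ s Pm Jm) (QHD.constA s Pm Jm)) Pm) := by
        rwa [neg_mul, neg_div]
      have ho := h.reverse.oscillatesAbout hk hμ hs' hPm hPp hlt.ne (hfm hPm.ne') hosc'
      exact ⟨(ho.nonMonotone ((continuous_fst.tendsto _).comp
        h.reverse.tendsto_atTop)).of_comp_neg, ho.of_comp_neg⟩
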